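/- **Theorem (An analytical Lieb–Sokal lemma).** A polynomial $p\in\mathbb{R}[z_1,\dots,z_n]$ is *real stable* if $p(z)\neq 0$ for all $z\in\mathbb{C}^n$ with $\operatorname{Im} z_i>0$ for every $i$, and *multiaffine* if it has degree at most $1$ in each variable. A point $\mathbf{a}\in\mathbb{R}^n$ *lies above the roots* of $p$ if $p(\mathbf{a}+\mathbf{t})\neq 0$ for all $\mathbf{t}\in\mathbb{R}^n$ with all coordinates $t_i\ge 0$. The *flip* of a multiaffine polynomial $q=\sum_{S\subseteq[n]}a_S\prod_{i\in S}z_i$ is $\overline{q}=\sum_{S\subseteq[n]}a_S\prod_{i\in[n]\setminus S}z_i$. Let $p,q\in\mathbb{R}[z_1,\dots,z_n]$ be multiaffine real stable polynomials, and let $r=q(\partial)p:=q(\partial_1,\dots,\partial_n)p$. Assume that $r$ is not identically zero. Let $\mathbf{a}$ lie above the roots of $p$, let $\mathbf{b}$ lie above the roots of $\overline{q}$, and put $$\varphi_i=\frac{\partial_i p}{p}(\mathbf{a})+\frac{\partial_i\overline{q}}{\overline{q}}(\mathbf{b}),\qquad i\in[n].$$ Then $\varphi_i>0$ for every $i$,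 and the point $$\mathbf{c}=\mathbf{a}+\mathbf{b}-\left(\frac1{\varphi_1},\dots,\frac1{\varphi_n}\right)$$ lies above the roots of $r$. -/

import Mathlib

open MvPolynomial

noncomputable section

/-- A polynomial is multiaffine if it has degree at most one in each variable. -/
def IsMultiaffine {n : ℕ} (p : MvPolynomial (Fin n) ℝ) : Prop :=
  ∀ i, p.degreeOf i ≤ 1

/-- A real polynomial is real stable if it does not vanish when all the variables lie in the
open upper half plane. (In particular the zero polynomial is not real stable.) -/
def IsRealStable {n : ℕ} (p : MvPolynomial (Fin n) ℝ) : Prop :=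
  ∀ z : Fin n → ℂ, (∀ i, 0 < (z i).im) → aeval z p ≠ 0

/-- The point `a` lies above the roots of `p` if `p` does not vanish on `a + t`, for all `t` in
the closed nonnegative orthant. -/
def LiesAboveRoots {n : ℕ} (a : Fin n → ℝ) (p : MvPolynomial (Fin n) ℝ) : Prop :=
  ∀ t : Fin n → ℝ, (∀ i, 0 ≤ t i) → eval (a + t) p ≠ 0

/-- The flip `∑ S, a_S z ^ ([n] \ S)` of a multiaffine polynomial `q = ∑ S, a_S z ^ S`. -/
def flipPoly {n : ℕ} (q : MvPolynomial (Fin n) ℝ) : MvPolynomial (Fin n) ℝ :=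
  ∑ S : Finset (Fin n), C (q.coeff (∑ i ∈ S, Finsupp.single i 1)) * ∏ i ∈ Sᶜ, X i

/-- The operator `∂ ^ m = ∂₁ ^ m₁ ∘ ⋯ ∘ ∂ₙ ^ mₙ` on polynomials. -/
def partialPow {n : ℕ} (m : Fin n →₀ ℕ) : Module.End ℝ (MvPolynomial (Fin n) ℝ) :=
  ((List.finRange n).map fun i =>
    ((pderiv i).toLinearMap : Module.End ℝ (MvPolynomial (Fin n) ℝ)) ^ m i).prod

/-- The polynomial `q(∂) p = q(∂₁, …, ∂ₙ) p`. -/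
def applyDiff {n : ℕ} (q p : MvPolynomial (Fin n) ℝ) : MvPolynomial (Fin n) ℝ :=
  ∑ m ∈ q.support, q.coeff m • partialPow m p

/-- The logarithmic potential `(∂ᵢ p / p)(a)`. -/
def logPotential {n : ℕ} (p : MvPolynomial (Fin n) ℝ) (i : Fin n) (a : Fin n → ℝ) : ℝ :=
  eval a (pderiv i p) / eval a p

end

open Function ComplexConjugate

/-! Double the variables and put `F(x, y) = p(x) * flip q (y)`, which is again multiaffine and
stable. Applying every `∂xᵢ + ∂yᵢ` to `F` gives `r(x + y)`, as a comparison of monomials shows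
(`eval_diagDerivs_mul_flipPoly`). So it suffices to follow a point above the roots through one
operator at a time.

Up to a scalar, `F` is positive above `(a, b)`, and there `φᵢ = (∂xᵢF + ∂yᵢF) / F`. Replace `F` by
`G = ∂xF + ∂yF`. Stability survives unless `G = 0`, because `Im (∂ᵢF * conj F) ≤ -Im zᵢ * |∂ᵢF|²`.
The vertex may be lowered by `F / G` in the direction `x` (`UpperStable.posAbove_update`), by the
Rayleigh inequality `F * ∂ᵢ∂ⱼF ≤ ∂ᵢF * ∂ⱼF` and the monotonicity of the barrier `G / F`. At the
lowered vertex each logarithmic derivative of `G` is at most that of `F` at the old one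
(`UpperStable.logDeriv_update_le`), so the bounds `φᵢ` persist and step `i` gains at least `1 / φᵢ`.
This last estimate is the heart of the proof: Rayleigh for `x, u` along a whole real line in
direction `y` is a nonnegative quadratic, and its discriminant gives the bound. -/

/-- A polynomial in arbitrary variables has degree at most one in each of them. -/
def DegreesLeOne {σ : Type*} (F : MvPolynomial σ ℝ) : Prop :=
  ∀ i, F.degreeOf i ≤ 1

/-- A real polynomial in arbitrary variables does not vanish on the open upper half space. -/
def UpperStable {σ : Type*} (F : MvPolynomial σ ℝ) : Prop :=
  ∀ z : σ → ℂ, (∀ i, 0 < (z i).im) → aeval z F ≠ 0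

/-! ### Multiaffine polynomials: affine dependence on each variable. -/

section Multiaffine

variable {σ : Type*}

theorem pderiv_comm (i j : σ) (F : MvPolynomial σ ℝ) :
    pderiv i (pderiv j F) = pderiv j (pderiv i F) := by
  classical
  ext m
  simp only [coeff_pderiv, Finsupp.add_apply, Finsupp.single_apply]
  rw [add_right_comm m]
  by_cases h : i = j
  · subst h; rfl
  · simp [h, Ne.symm h]; ring

theorem DegreesLeOne.pderiv {F : MvPolynomial σ ℝ} (hF : DegreesLeOne F) (i : σ) :
    DegreesLeOne (pderiv i F) := by
  classical
  intro j
  rw [degreeOf_le_iff]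
  intro m hm
  rw [mem_support_iff, coeff_pderiv] at hm
  have := (degreeOf_le_iff.1 (hF j)) _ (mem_support_iff.2 (left_ne_zero_of_mul hm))
  rw [Finsupp.add_apply] at this
  omega

theorem DegreesLeOne.pderiv_self {F : MvPolynomial σ ℝ} (hF : DegreesLeOne F) (i : σ) :
    MvPolynomial.pderiv i (MvPolynomial.pderiv i F) = 0 := by
  classical
  ext m
  simp only [coeff_pderiv, coeff_zero]
  by_contra h
  have h1 := left_ne_zero_of_mul (left_ne_zero_of_mul h)
  have := (degreeOf_le_iff.1 (hF i)) _ (mem_support_iff.2 h1)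
  simp at this

theorem DegreesLeOne.add {F G : MvPolynomial σ ℝ} (hF : DegreesLeOne F) (hG : DegreesLeOne G) :
    DegreesLeOne (F + G) := fun i =>
  (degreeOf_add_le i F G).trans (max_le (hF i) (hG i))

/-- A multiaffine polynomial is affine in each variable, with slope its partial derivative. -/
theorem DegreesLeOne.aeval_update [DecidableEq σ] {A : Type*} [CommRing A] [Algebra ℝ A]
    {F : MvPolynomial σ ℝ} (hF : DegreesLeOne F) (z : σ → A) (i : σ) (w : A) :
    aeval (update z i w) F = aeval z F + (w - z i) * aeval z (MvPolynomial.pderiv i F) := by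
  have key : ∀ m ∈ F.support, aeval (update z i w) (monomial m (F.coeff m)) =
      aeval z (monomial m (F.coeff m)) +
        (w - z i) * aeval z (MvPolynomial.pderiv i (monomial m (F.coeff m))) := by
    intro m hm
    have h1 := (degreeOf_le_iff.1 (hF i)) m hm
    have hprod : ∀ (k : σ →₀ ℕ) (v : A), k i = 0 →
        (k.prod fun j e => (update z i v) j ^ e) = k.prod fun j e => z j ^ e := by
      intro k v hk
      refine Finsupp.prod_congr fun j hj => ?_
      have : j ≠ i := by rintro rfl; simp [hk] at hj
      rw [update_of_ne this]
    rcases Nat.le_one_iff_eq_zero_or_eq_one.1 h1 with h0 | h0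
    · simp [aeval_monomial, pderiv_monomial, h0, hprod]
    · obtain ⟨k, rfl⟩ : ∃ k, m = k + Finsupp.single i 1 :=
        ⟨m - Finsupp.single i 1, by
          rw [tsub_add_cancel_of_le]; simpa using h0.ge⟩
      have hk : k i = 0 := by simpa using h0
      have hadd : ∀ v : σ → A, ((k + Finsupp.single i 1).prod fun j e => v j ^ e) =
          (k.prod fun j e => v j ^ e) * v i := by
        intro v
        rw [Finsupp.prod_add_index' (by simp) (by intros; ring)]
        simp
      simp only [aeval_monomial, pderiv_monomial, hadd, hprod k w hk]
      simp [hk]; ring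
  have hs := F.as_sum
  conv_lhs => rw [hs]
  conv_rhs => rw [hs]
  simp only [map_sum, Finset.mul_sum]
  rw [← Finset.sum_add_distrib]
  exact Finset.sum_congr rfl key

theorem DegreesLeOne.eval_update [DecidableEq σ] {F : MvPolynomial σ ℝ} (hF : DegreesLeOne F)
    (v : σ → ℝ) (i : σ) (w : ℝ) :
    eval (update v i w) F = eval v F + (w - v i) * eval v (MvPolynomial.pderiv i F) := by
  simpa [coe_aeval_eq_eval] using hF.aeval_update v i w

theorem continuous_aeval_complex (F : MvPolynomial σ ℝ) :
    Continuous fun z : σ → ℂ => aeval z F := by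
  have : (fun z : σ → ℂ => aeval z F) = fun z => eval z (map (algebraMap ℝ ℂ) F) := by
    ext z; rw [eval_map, aeval_def]
  rw [this]
  exact continuous_eval _

theorem aeval_ofReal (F : MvPolynomial σ ℝ) (v : σ → ℝ) :
    aeval (fun i => (v i : ℂ)) F = ((eval v F : ℝ) : ℂ) := by
  rw [← coe_aeval_eq_eval]
  exact aeval_algebraMap_apply ℂ v F

theorem eq_zero_of_aeval_upperHalf_eq_zero {G : MvPolynomial σ ℝ}
    (h : ∀ z : σ → ℂ, (∀ i, 0 < (z i).im) → aeval z G = 0) : G = 0 := by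
  have : map (algebraMap ℝ ℂ) G = 0 := by
    refine MvPolynomial.funext_set (fun _ => {w : ℂ | 0 < w.im}) (fun _ => ?_) fun z hz => ?_
    · refine Set.infinite_of_injective_forall_mem (f := fun k : ℕ => (k : ℂ) + Complex.I) ?_ ?_
      · intro a b hab; simpa using hab
      · intro k; simp
    · rw [eval_map, ← aeval_def, map_zero]
      exact h z fun i => hz i trivial
  exact map_injective _ (algebraMap ℝ ℂ).injective (by simpa using this)

end Multiaffine

/-! ### Stability, the Rayleigh inequality and `∂ᵢ + ∂ⱼ`. -/

section Stable

variable {σ : Type*} [DecidableEq σ] {F : MvPolynomial σ ℝ}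

/-- The logarithmic derivatives of a multiaffine stable polynomial have nonpositive imaginary part
on the upper half space, quantitatively. -/
theorem UpperStable.im_pderiv_mul_conj_le (hF : DegreesLeOne F) (hs : UpperStable F)
    {z : σ → ℂ} (hz : ∀ i, 0 < (z i).im) (i : σ) :
    (aeval z (pderiv i F) * conj (aeval z F)).im ≤
      -(z i).im * Complex.normSq (aeval z (pderiv i F)) := by
  by_contra! h
  set Q := aeval z (pderiv i F) with hQ
  set P := aeval z F with hP
  have hQ0 : Q ≠ 0 := by rintro h0; simp [h0] at h
  have hN : 0 < Complex.normSq Q := Complex.normSq_pos.2 hQ0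
  -- This is the root of `F` in its `i`-th variable; the negated inequality puts it in the upper
  -- half plane.
  refine hs (update z i (z i - P / Q)) ?_ ?_
  · intro j
    by_cases hj : j = i
    · subst hj
      have : (P / Q).im = -(Q * conj P).im / Complex.normSq Q := by
        rw [Complex.div_im]; simp; field_simp; ring
      rw [update_self, Complex.sub_im, this, neg_div, sub_neg_eq_add]
      have h2 : -(z j).im < (Q * conj P).im / Complex.normSq Q := by rwa [lt_div_iff₀ hN]
      linarith
    · rw [update_of_ne hj]; exact hz j
  · rw [hF.aeval_update, ← hQ, ← hP]
    field_simp
    ring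

theorem UpperStable.im_pderiv_mul_conj_nonpos (hF : DegreesLeOne F) (hs : UpperStable F)
    {z : σ → ℂ} (hz : ∀ i, 0 ≤ (z i).im) (i : σ) :
    (aeval z (pderiv i F) * conj (aeval z F)).im ≤ 0 := by
  have hc : Continuous fun e : ℝ => (aeval (fun j => z j + e * Complex.I) (pderiv i F) *
      conj (aeval (fun j => z j + e * Complex.I) F)).im := by
    have h1 : Continuous fun e : ℝ => (fun j => z j + e * Complex.I : σ → ℂ) := by fun_prop
    exact Complex.continuous_im.comp (((continuous_aeval_complex _).comp h1).mul
      (Complex.continuous_conj.comp ((continuous_aeval_complex _).comp h1)))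
  have ht := hc.continuousWithinAt (s := Set.Ioi 0) (x := 0)
  have := le_of_tendsto ht (b := 0) (by
    filter_upwards [self_mem_nhdsWithin] with e he
    have he : 0 < e := he
    have hz' : ∀ j, 0 < (z j + e * Complex.I).im := by
      intro j; simp; linarith [hz j]
    refine (hs.im_pderiv_mul_conj_le hF hz' i).trans ?_
    nlinarith [hz' i, Complex.normSq_nonneg (aeval (fun j => z j + e * Complex.I) (pderiv i F))])
  simpa using this

/-- The strong Rayleigh inequality. -/
theorem UpperStable.rayleigh (hF : DegreesLeOne F) (hs : UpperStable F) (v : σ → ℝ) (i j : σ) :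
    eval v F * eval v (pderiv j (pderiv i F)) ≤
      eval v (pderiv i F) * eval v (pderiv j F) := by
  -- At `v + I eⱼ` the product is `(∂ᵢF + I ∂ⱼ∂ᵢF)(F - I ∂ⱼF)`, whose imaginary part is the Rayleigh
  -- difference.
  have h := hs.im_pderiv_mul_conj_nonpos hF
    (z := update (fun k => (v k : ℂ)) j (v j + Complex.I)) (by
      intro k
      by_cases hk : k = j
      · subst hk; simp
      · simp [hk]) i
  rw [hF.aeval_update, (hF.pderiv i).aeval_update] at h
  simp only [aeval_ofReal] at h
  simp at h
  linarith

/-- If a partial derivative of a stable polynomial vanishes at a point of the upper half space,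
then it does not vary there. -/
theorem UpperStable.pderiv_pderiv_eq_zero (hF : DegreesLeOne F) (hs : UpperStable F)
    {z : σ → ℂ} (hz : ∀ i, 0 < (z i).im) {i : σ} (h0 : aeval z (pderiv i F) = 0) (j : σ) :
    aeval z (pderiv j (pderiv i F)) = 0 := by
  set R := aeval z (pderiv j (pderiv i F)) with hR
  set P := aeval z F with hP
  -- Moving `zⱼ` by `t * I * conj u` gives `∂ᵢF * conj F` the imaginary part `t * (|u|² + t * M)`.
  -- It is nonpositive for small `t > 0`, which forces `u = 0`.
  set u := R * conj P with hu
  set M := (Complex.I * conj u * R * conj (Complex.I * conj u * aeval z (pderiv j F))).im with hM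
  have key : ∀ᶠ t : ℝ in nhdsWithin 0 (Set.Ioi 0), Complex.normSq u + t * M ≤ 0 := by
    have hc : Continuous fun t : ℝ => (z j + t * (Complex.I * conj u)).im := by fun_prop
    have hpos : ∀ᶠ t : ℝ in nhdsWithin 0 (Set.Ioi 0), 0 < (z j + t * (Complex.I * conj u)).im :=
      (hc.continuousWithinAt (x := 0)).eventually (lt_mem_nhds (by simpa using hz j))
    filter_upwards [hpos, self_mem_nhdsWithin] with t ht ht0
    have ht0 : 0 < t := ht0
    have h := hs.im_pderiv_mul_conj_nonpos hF
      (z := update z j (z j + t * (Complex.I * conj u))) (by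
        intro k
        by_cases hk : k = j
        · subst hk; simpa using ht.le
        · simpa [hk] using (hz k).le) i
    rw [hF.aeval_update, (hF.pderiv i).aeval_update, h0, ← hR, ← hP] at h
    have e : ((0 + (z j + t * (Complex.I * conj u) - z j) * R) *
        conj (P + (z j + t * (Complex.I * conj u) - z j) * aeval z (pderiv j F))).im =
        t * (Complex.normSq u + t * M) := by
      have : ((0 + (z j + t * (Complex.I * conj u) - z j) * R) *
        conj (P + (z j + t * (Complex.I * conj u) - z j) * aeval z (pderiv j F))) =
        t * (Complex.I * (u * conj u) + t * (Complex.I * conj u * R *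
          conj (Complex.I * conj u * aeval z (pderiv j F)))) := by
        simp only [map_add, map_mul, map_sub, Complex.conj_ofReal, hu]
        ring
      rw [this, Complex.mul_conj, Complex.im_ofReal_mul, Complex.add_im, Complex.im_ofReal_mul, hM]
      simp
    rw [e] at h
    exact nonpos_of_mul_nonpos_right h ht0
  have hlim : Filter.Tendsto (fun t : ℝ => Complex.normSq u + t * M) (nhdsWithin 0 (Set.Ioi 0))
      (nhds (Complex.normSq u + 0 * M)) :=
    (Continuous.continuousWithinAt (by fun_prop : Continuous fun t : ℝ => Complex.normSq u + t * M))
  have := le_of_tendsto hlim key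
  have hu0 : u = 0 := Complex.normSq_eq_zero.1
    (le_antisymm (by simpa using this) (Complex.normSq_nonneg u))
  rcases mul_eq_zero.1 hu0 with h | h
  · exact h
  · exact absurd ((map_eq_zero _).1 h) (hs z hz)

/-- A zero of `∂ᵢF` persists when one coordinate is changed, so any point of the upper half space is
reached coordinate by coordinate. -/
theorem UpperStable.pderiv_eq_zero [Fintype σ] (hF : DegreesLeOne F) (hs : UpperStable F)
    {z : σ → ℂ} (hz : ∀ i, 0 < (z i).im) {i : σ} (h0 : aeval z (pderiv i F) = 0) :
    pderiv i F = 0 := by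
  refine eq_zero_of_aeval_upperHalf_eq_zero fun w hw => ?_
  have key : ∀ s : Finset σ, aeval (s.piecewise w z) (pderiv i F) = 0 := by
    intro s
    induction s using Finset.induction_on with
    | empty => simpa using h0
    | insert j s hj ih =>
      rw [Finset.piecewise_insert, (hF.pderiv i).aeval_update, ih,
        hs.pderiv_pderiv_eq_zero hF (fun k => ?_) ih j]
      · simp
      · by_cases hk : k ∈ s <;> simp [hk, hw, hz]
  simpa using key Finset.univ

/-- At a zero of the sum the two imaginary parts cancel, though each is at most `-Im z * |∂F|²`.
Hence both derivatives vanish there, and so identically. -/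
theorem UpperStable.pderiv_add_pderiv [Fintype σ] (hF : DegreesLeOne F) (hs : UpperStable F)
    (i j : σ) (h : pderiv i F + pderiv j F ≠ 0) : UpperStable (pderiv i F + pderiv j F) := by
  intro z hz h0
  have hi := hs.im_pderiv_mul_conj_le hF hz i
  have hj := hs.im_pderiv_mul_conj_le hF hz j
  rw [map_add] at h0
  have hsum : (aeval z (pderiv i F) * conj (aeval z F)).im +
      (aeval z (pderiv j F) * conj (aeval z F)).im = 0 := by
    rw [← Complex.add_im, ← add_mul, h0]; simp
  have ni := mul_nonneg (hz i).le (Complex.normSq_nonneg (aeval z (pderiv i F)))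
  have nj := mul_nonneg (hz j).le (Complex.normSq_nonneg (aeval z (pderiv j F)))
  have zero : ∀ k, (z k).im * Complex.normSq (aeval z (pderiv k F)) = 0 → pderiv k F = 0 := by
    intro k hk
    refine hs.pderiv_eq_zero hF hz (Complex.normSq_eq_zero.1 ?_)
    exact (mul_eq_zero.1 hk).resolve_left (hz k).ne'
  apply h
  rw [zero i (by linarith), zero j (by linarith), add_zero]

end Stable

/-! ### Barriers on an orthant above the roots. -/

/-- A polynomial is positive on the closed orthant with vertex `a`. -/
def PosAbove {σ : Type*} (a : σ → ℝ) (F : MvPolynomial σ ℝ) : Prop :=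
  ∀ v, a ≤ v → 0 < eval v F

section Barrier

variable {σ : Type*} {F : MvPolynomial σ ℝ} {a : σ → ℝ}

theorem eq_zero_of_eval_orthant_eq_zero {G : MvPolynomial σ ℝ}
    (h : ∀ v, a ≤ v → eval v G = 0) : G = 0 :=
  MvPolynomial.funext_set (fun i => Set.Ici (a i)) (fun i => Set.Ici_infinite (a i))
    fun v hv => by rw [map_zero]; exact h v fun i => hv i trivial

theorem PosAbove.mono (h : PosAbove a F) {b : σ → ℝ} (hab : a ≤ b) : PosAbove b F :=
  fun v hv => h v (hab.trans hv)

variable [DecidableEq σ]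

theorem le_update_add {v : σ → ℝ} (hv : a ≤ v) (i : σ) {t : ℝ} (ht : 0 ≤ t) :
    a ≤ update v i (v i + t) := by
  intro k
  by_cases hk : k = i
  · subst hk; simpa using add_le_add (hv k) ht
  · simpa [hk] using hv k

/-- An orthant is reached from its vertex by successively increasing single coordinates. -/
theorem orthant_induction [Fintype σ] {P : (σ → ℝ) → Prop} (h0 : P a)
    (hstep : ∀ v, a ≤ v → P v → ∀ i t, 0 ≤ t → P (update v i (v i + t))) :
    ∀ v, a ≤ v → P v := by
  intro v hv
  have key : ∀ s : Finset σ, a ≤ s.piecewise v a ∧ P (s.piecewise v a) := by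
    intro s
    induction s using Finset.induction_on with
    | empty => simpa using h0
    | insert j s hj ih =>
      have e : (insert j s).piecewise v a =
          update (s.piecewise v a) j (s.piecewise v a j + (v j - a j)) := by
        rw [Finset.piecewise_insert]; simp [hj]
      have hj0 : 0 ≤ v j - a j := sub_nonneg.2 (hv j)
      rw [e]
      exact ⟨le_update_add ih.1 j hj0, hstep _ ih.1 ih.2 j _ hj0⟩
  simpa using (key Finset.univ).2

/-- With a negative slope, the affine function of the `i`-th variable would reach zero inside the
orthant. -/
theorem PosAbove.pderiv_nonneg (hF : DegreesLeOne F) (h : PosAbove a F) (i : σ)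
    {v : σ → ℝ} (hv : a ≤ v) : 0 ≤ eval v (pderiv i F) := by
  by_contra! hneg
  have hp := h v hv
  have ht : 0 ≤ -(eval v F / eval v (pderiv i F)) :=
    neg_nonneg.2 (div_nonpos_of_nonneg_of_nonpos hp.le hneg.le)
  have := h _ (le_update_add hv i ht)
  rw [hF.eval_update] at this
  field_simp [hneg.ne] at this
  simp at this

theorem PosAbove.pderiv_pderiv_nonneg (hF : DegreesLeOne F) (h : PosAbove a F) (i j : σ)
    {v : σ → ℝ} (hv : a ≤ v) : 0 ≤ eval v (pderiv j (pderiv i F)) := by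
  by_contra! hneg
  have hp := h.pderiv_nonneg hF i hv
  have ht : 0 ≤ (eval v (pderiv i F) + 1) / -eval v (pderiv j (pderiv i F)) :=
    div_nonneg (by linarith) (by linarith)
  have := h.pderiv_nonneg hF i (le_update_add hv j ht)
  rw [(hF.pderiv i).eval_update] at this
  have e : ((v j + (eval v (pderiv i F) + 1) / -eval v (pderiv j (pderiv i F))) - v j) *
      eval v (pderiv j (pderiv i F)) = -(eval v (pderiv i F) + 1) := by
    field_simp [hneg.ne]; ring
  rw [e] at this
  linarith

/-- The sum of two logarithmic derivatives is nonincreasing on an orthant above the roots. -/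
theorem UpperStable.barrier_antitone [Fintype σ] (hF : DegreesLeOne F) (hs : UpperStable F)
    (h : PosAbove a F) (x y : σ) {v : σ → ℝ} (hv : a ≤ v) :
    eval v (pderiv x F + pderiv y F) * eval a F ≤
      eval a (pderiv x F + pderiv y F) * eval v F := by
  refine orthant_induction
    (P := fun v => eval v (pderiv x F + pderiv y F) * eval a F ≤
      eval a (pderiv x F + pderiv y F) * eval v F) le_rfl ?_ v hv
  intro v hv ih i t ht
  have hG := (hF.pderiv x).add (hF.pderiv y)
  rw [hF.eval_update, hG.eval_update]
  have hA := h a le_rfl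
  have hFv := h v hv
  have hFi := h.pderiv_nonneg hF i hv
  have hr : eval v F * eval v (pderiv i (pderiv x F + pderiv y F)) ≤
      eval v (pderiv x F + pderiv y F) * eval v (pderiv i F) := by
    have h1 := hs.rayleigh hF v x i
    have h2 := hs.rayleigh hF v y i
    simp only [map_add]
    linarith
  have hi : eval v (pderiv i (pderiv x F + pderiv y F)) * eval a F ≤
      eval a (pderiv x F + pderiv y F) * eval v (pderiv i F) := by
    refine le_of_mul_le_mul_left ?_ hFv
    have h1 := mul_le_mul_of_nonneg_right hr hA.le
    have h2 := mul_le_mul_of_nonneg_right ih hFi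
    linarith
  have := mul_le_mul_of_nonneg_left hi ht
  rw [add_sub_cancel_left]
  linarith

/-- By monotonicity of the barrier, a zero of the nonnegative sum spreads to the orthant above it,
which makes the sum the zero polynomial. -/
theorem UpperStable.posAbove_pderiv_add_pderiv [Fintype σ] (hF : DegreesLeOne F)
    (hs : UpperStable F) (h : PosAbove a F) (x y : σ) (hG : pderiv x F + pderiv y F ≠ 0) :
    PosAbove a (pderiv x F + pderiv y F) := by
  have hnn : ∀ v, a ≤ v → 0 ≤ eval v (pderiv x F + pderiv y F) := fun v hv => by
    rw [map_add]
    exact add_nonneg (h.pderiv_nonneg hF x hv) (h.pderiv_nonneg hF y hv)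
  intro v hv
  refine lt_of_le_of_ne (hnn v hv) fun h0 => hG (eq_zero_of_eval_orthant_eq_zero (a := v) ?_)
  intro w hw
  have := hs.barrier_antitone hF (h.mono hv) x y hw
  rw [← h0, zero_mul] at this
  exact le_antisymm (nonpos_of_mul_nonpos_left this (h v hv)) (hnn w (hv.trans hw))

/-- The algebra behind `UpperStable.logDeriv_update_le`: `A, B, C, D` stand for `F, ∂xF, ∂yF,
∂x∂yF`, and `U, Bu, Cu, Du` for their `u`-derivatives. The hypothesis `hq` is Rayleigh for `x, u` at
height `t` in direction `y`. -/
theorem mul_le_of_quadratic_nonneg {A B C D U Bu Cu Du : ℝ} (hA : 0 < A) (hB : 0 ≤ B)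
    (hC : 0 ≤ C) (hD : 0 ≤ D) (hβ : A * Cu ≤ C * U)
    (hq : ∀ t : ℝ, (A + t * C) * (Bu + t * Du) ≤ (B + t * D) * (U + t * Cu)) :
    A * (D * U - A * Du) ≤ (B + C) * ((B * U - A * Bu) + (C * U - A * Cu)) := by
  have hα : A * Bu ≤ B * U := by simpa using hq 0
  have hdisc := discrim_le_zero (a := D * Cu - C * Du)
    (b := B * Cu + D * U - A * Du - C * Bu) (c := B * U - A * Bu)
    (fun t => by have := hq t; nlinarith)
  obtain ⟨α, hα'⟩ : ∃ α, α = B * U - A * Bu := ⟨_, rfl⟩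
  obtain ⟨β, hβ'⟩ : ∃ β, β = C * U - A * Cu := ⟨_, rfl⟩
  obtain ⟨E, hE⟩ : ∃ E, E = A * (D * U - A * Du) := ⟨_, rfl⟩
  have hα0 : 0 ≤ α := by linarith
  have hβ0 : 0 ≤ β := by linarith
  have h1 : (E + C * α - B * β) ^ 2 - 4 * α * (C * E - A * D * β) ≤ 0 := by
    have e : (E + C * α - B * β) ^ 2 - 4 * α * (C * E - A * D * β) =
        A ^ 2 * discrim (D * Cu - C * Du) (B * Cu + D * U - A * Du - C * Bu) (B * U - A * Bu) := by
      rw [discrim, hE, hα', hβ']; ring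
    rw [e]
    exact mul_nonpos_of_nonneg_of_nonpos (sq_nonneg A) hdisc
  have h2 : 0 ≤ α * (A * D * β) := by positivity
  rw [← hα', ← hβ', ← hE]
  by_contra! hlt
  have h3 : 0 ≤ B * α + C * β := by positivity
  -- The discriminant bound says `(E - Cα - Bβ)² ≤ 4BCαβ - 4ADαβ`, which is at most `(Bα + Cβ)²`;
  -- this contradicts the strict inequality.
  have h4 : (B * α + C * β) ^ 2 < (E - C * α - B * β) ^ 2 :=
    pow_lt_pow_left₀ (by linarith) h3 two_ne_zero
  nlinarith [sq_nonneg (B * α - C * β)]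

/-- One step of the barrier argument: replacing `F` by `∂ₓF + ∂ᵧF` allows the vertex to be lowered
by the reciprocal of the barrier. -/
theorem UpperStable.posAbove_update [Fintype σ] (hF : DegreesLeOne F)
    (hs : UpperStable F) (h : PosAbove a F) {x y : σ}
    (hG : pderiv x F + pderiv y F ≠ 0) :
    PosAbove (update a x (a x - eval a F / eval a (pderiv x F + pderiv y F)))
      (pderiv x F + pderiv y F) := by
  have hpos := hs.posAbove_pderiv_add_pderiv hF h x y hG
  have hGd := (hF.pderiv x).add (hF.pderiv y)
  set G := pderiv x F + pderiv y F with hGdef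
  set s := eval a F / eval a G with hsdef
  have hGa := hpos a le_rfl
  intro v hv
  set w := update v x (v x + s) with hw
  have haw : a ≤ w := by
    intro k
    have := hv k
    by_cases hk : k = x
    · subst hk; simp [hw] at this ⊢; linarith
    · simpa [hw, hk] using this
  have hvw : v = update w x (w x - s) := by simp [hw]
  have hder : pderiv x G = pderiv y (pderiv x F) := by
    rw [hGdef, map_add, hF.pderiv_self, zero_add, pderiv_comm]
  have hD := h.pderiv_pderiv_nonneg hF x y haw
  have hanti := hs.barrier_antitone hF h x y haw
  have hray := hs.rayleigh hF w x y
  have hB := h.pderiv_nonneg hF x haw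
  have hC := h.pderiv_nonneg hF y haw
  have hGw := hpos w haw
  rw [hvw, hGd.eval_update, hder]
  -- By Rayleigh the difference is at least `(B + C)² - BC`, where `B, C ≥ 0` and `B + C > 0`.
  have hsq : 0 < eval w G * eval w G - eval w F * eval w (pderiv y (pderiv x F)) := by
    have e : eval w G = eval w (pderiv x F) + eval w (pderiv y F) := by rw [hGdef, map_add]
    have := mul_nonneg hB hC
    have hp : 0 < eval w G * eval w G := mul_pos hGw hGw
    rw [e] at hp ⊢
    nlinarith [sq_nonneg (eval w (pderiv x F) - eval w (pderiv y F))]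
  have hs1 : s * eval w G ≤ eval w F := by
    rw [hsdef, div_mul_eq_mul_div, div_le_iff₀ hGa]; linarith
  have h2 := mul_le_mul_of_nonneg_right hs1 hD
  refine (mul_pos_iff_of_pos_right hGw).1 ?_
  linarith

/-- In one step of the barrier argument, the other logarithmic derivatives do not increase. -/
theorem UpperStable.logDeriv_update_le [Fintype σ] (hF : DegreesLeOne F)
    (hs : UpperStable F) (h : PosAbove a F) {x y u : σ}
    (hG : pderiv x F + pderiv y F ≠ 0) :
    eval (update a x (a x - eval a F / eval a (pderiv x F + pderiv y F)))
        (pderiv u (pderiv x F + pderiv y F)) * eval a F ≤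
      eval a (pderiv u F) *
        eval (update a x (a x - eval a F / eval a (pderiv x F + pderiv y F)))
          (pderiv x F + pderiv y F) := by
  have hGa := hs.posAbove_pderiv_add_pderiv hF h x y hG a le_rfl
  have hGd := (hF.pderiv x).add (hF.pderiv y)
  have hA := h a le_rfl
  rw [hGd.eval_update, (hGd.pderiv u).eval_update]
  simp only [map_add, hF.pderiv_self, pderiv_comm x u, zero_add, map_zero] at hGa ⊢
  have key := mul_le_of_quadratic_nonneg (A := eval a F) (B := eval a (pderiv x F))
    (C := eval a (pderiv y F)) (D := eval a (pderiv x (pderiv y F))) (U := eval a (pderiv u F))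
    (Bu := eval a (pderiv u (pderiv x F))) (Cu := eval a (pderiv u (pderiv y F)))
    (Du := eval a (pderiv u (pderiv x (pderiv y F)))) hA (h.pderiv_nonneg hF x le_rfl)
    (h.pderiv_nonneg hF y le_rfl) (h.pderiv_pderiv_nonneg hF y x le_rfl)
    (hs.rayleigh hF a y u) (fun t => by
      have := hs.rayleigh hF (update a y (a y + t)) x u
      rw [hF.eval_update, (hF.pderiv x).eval_update, (hF.pderiv u).eval_update,
        ((hF.pderiv x).pderiv u).eval_update] at this
      simp only [add_sub_cancel_left, pderiv_comm y u, pderiv_comm y x] at this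
      exact this)
  set g := eval a (pderiv x F) + eval a (pderiv y F) with hg
  set A := eval a F
  have hdiv := (div_mul_cancel₀ A hGa.ne')
  set s := A / g
  -- Multiplying by `g` and using `s * g = A` turns the claim into `key`.
  refine le_of_mul_le_mul_right ?_ hGa
  clear_value s
  linear_combination key + (eval a (pderiv u F) * eval a (pderiv x (pderiv y F)) -
    A * eval a (pderiv u (pderiv x (pderiv y F)))) * hdiv - g * eval a (pderiv u F) * hg

end Barrier

/-! ### Iterating the barrier step over all the variables. -/

/-- The derivation `∂ / ∂xᵢ + ∂ / ∂yᵢ` on polynomials in the variables `x` and `y`. -/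
noncomputable def diagDeriv {n : ℕ} (i : Fin n) :
    Derivation ℝ (MvPolynomial (Fin n ⊕ Fin n) ℝ) (MvPolynomial (Fin n ⊕ Fin n) ℝ) :=
  pderiv (Sum.inl i) + pderiv (Sum.inr i)

/-- The composition of the operators `∂ / ∂xᵢ + ∂ / ∂yᵢ`, for `i` in a list. -/
noncomputable def diagDerivs {n : ℕ} (l : List (Fin n)) :
    Module.End ℝ (MvPolynomial (Fin n ⊕ Fin n) ℝ) :=
  (l.map fun i => ((diagDeriv i).toLinearMap : Module.End ℝ _)).prod

section Iteration

variable {n : ℕ}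

theorem diagDeriv_apply (i : Fin n) (F : MvPolynomial (Fin n ⊕ Fin n) ℝ) :
    diagDeriv i F = pderiv (Sum.inl i) F + pderiv (Sum.inr i) F := rfl

theorem diagDerivs_cons (i : Fin n) (l : List (Fin n)) (F : MvPolynomial (Fin n ⊕ Fin n) ℝ) :
    diagDerivs (i :: l) F = diagDeriv i (diagDerivs l F) := by
  simp [diagDerivs]

/-- The iterated barrier argument. -/
theorem UpperStable.exists_posAbove_diagDerivs {F : MvPolynomial (Fin n ⊕ Fin n) ℝ}
    (hF : DegreesLeOne F) (hs : UpperStable F) {a : Fin n ⊕ Fin n → ℝ} (h : PosAbove a F)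
    {φ : Fin n → ℝ} (hφ : ∀ i, eval a (diagDeriv i F) ≤ φ i * eval a F)
    (l : List (Fin n)) (hl : l.Nodup) (h0 : diagDerivs l F ≠ 0) :
    DegreesLeOne (diagDerivs l F) ∧ UpperStable (diagDerivs l F) ∧ (∀ i ∈ l, 0 < φ i) ∧
      ∃ a' : Fin n ⊕ Fin n → ℝ, PosAbove a' (diagDerivs l F) ∧
        (∀ i, a' (Sum.inl i) ≤ a (Sum.inl i) - if i ∈ l then 1 / φ i else 0) ∧
        (∀ i, a' (Sum.inr i) ≤ a (Sum.inr i)) ∧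
        ∀ i, eval a' (diagDeriv i (diagDerivs l F)) ≤ φ i * eval a' (diagDerivs l F) := by
  induction l with
  | nil =>
    have e : diagDerivs [] F = F := by simp [diagDerivs]
    rw [e]
    exact ⟨hF, hs, by simp, a, h, by simp, by simp, hφ⟩
  | cons i l ih =>
    rw [diagDerivs_cons] at h0 ⊢
    rw [List.nodup_cons] at hl
    obtain ⟨hd, hst, hpos, a', ha', hx, hy, hpot⟩ := ih hl.2 (by rintro h; simp [h] at h0)
    set H := diagDerivs l F
    rw [diagDeriv_apply] at h0 ⊢
    have hA := ha' a' le_rfl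
    have hG := hst.posAbove_pderiv_add_pderiv hd ha' _ _ h0 a' le_rfl
    have hi := hpot i
    rw [diagDeriv_apply] at hi
    have hφi : 0 < φ i := (mul_pos_iff_of_pos_right hA).1 (hG.trans_le hi)
    have hP := hst.posAbove_update hd ha' h0
    refine ⟨(hd.pderiv _).add (hd.pderiv _), hst.pderiv_add_pderiv hd _ _ h0, ?_, _,
      hP, ?_, ?_, ?_⟩
    · simpa [hφi] using hpos
    · intro j
      by_cases hj : j = i
      · subst hj
        have h1 := hx j
        simp only [hl.1, if_false, sub_zero] at h1
        -- The potential at the current vertex is still at most `φ j`, so the drop is at least `1 /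
        -- φ j`.
        have h2 : 1 / φ j ≤ eval a' H / eval a' (pderiv (Sum.inl j) H + pderiv (Sum.inr j) H) := by
          rw [div_le_div_iff₀ hφi hG]; linarith
        simp only [update_self, List.mem_cons, true_or, if_true]
        linarith
      · simpa [hj] using hx j
    · intro j
      simpa using hy j
    · intro j
      have h1 := hst.logDeriv_update_le hd ha' (u := Sum.inl j) h0
      have h2 := hst.logDeriv_update_le hd ha' (u := Sum.inr j) h0
      have h3 := hpot j
      rw [diagDeriv_apply, map_add] at h3 ⊢
      have hP0 := hP _ le_rfl
      refine le_of_mul_le_mul_right ?_ hA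
      have h4 := mul_le_mul_of_nonneg_right h3 hP0.le
      linarith

end Iteration

/-! ### Derivations acting on separate factors. -/

section Product

theorem Derivation.map_prod_eq_zero {ι A : Type*} [CommRing A] [Algebra ℝ A]
    (D : Derivation ℝ A A) (s : Finset ι) (u : ι → A) (h : ∀ j ∈ s, D (u j) = 0) :
    D (∏ j ∈ s, u j) = 0 := by
  classical
  induction s using Finset.induction_on with
  | empty => simp
  | insert i s hi ih =>
    rw [Finset.prod_insert hi, D.leibniz, h i (by simp), ih fun j hj => h j (by simp [hj])]
    simp

theorem Derivation.pow_apply_mul {A : Type*} [CommRing A] [Algebra ℝ A]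
    (D : Derivation ℝ A A) {w : A} (h : D w = 0) (k : ℕ) (u : A) :
    ((D.toLinearMap : Module.End ℝ A) ^ k) (u * w) =
      ((D.toLinearMap : Module.End ℝ A) ^ k) u * w := by
  induction k with
  | zero => simp
  | succ k ih =>
    rw [pow_succ', Module.End.mul_apply, Module.End.mul_apply, ih]
    simp [D.leibniz, h, mul_comm]

/-- Powers of derivations acting on separate factors of a product act factorwise. -/
theorem list_prod_pow_derivation_apply_prod {ι A : Type*} [Fintype ι] [DecidableEq ι] [CommRing A]
    [Algebra ℝ A] (D : ι → Derivation ℝ A A) (k : ι → ℕ) (m m' : ι → A)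
    (hm : ∀ i j, j ≠ i → D i (m j) = 0) (hm' : ∀ i j, j ≠ i → D i (m' j) = 0)
    (h : ∀ i, (((D i).toLinearMap : Module.End ℝ A) ^ k i) (m i) = m' i)
    (l : List ι) (hl : l.Nodup) :
    (l.map fun i => ((D i).toLinearMap : Module.End ℝ A) ^ k i).prod (∏ j, m j) =
      ∏ j, if j ∈ l then m' j else m j := by
  induction l with
  | nil => simp
  | cons i l ih =>
    rw [List.nodup_cons] at hl
    rw [List.map_cons, List.prod_cons, Module.End.mul_apply, ih hl.2,
      ← Finset.mul_prod_erase _ _ (Finset.mem_univ i), if_neg hl.1,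
      Derivation.pow_apply_mul, h, ← Finset.mul_prod_erase _ _ (Finset.mem_univ i)]
    · congr 1
      · simp
      · refine Finset.prod_congr rfl fun j hj => ?_
        simp [Finset.ne_of_mem_erase hj]
    · refine Derivation.map_prod_eq_zero _ _ _ fun j hj => ?_
      have := Finset.ne_of_mem_erase hj
      split_ifs
      · exact hm' i j this
      · exact hm i j this

end Product

/-! ### The flip, and `q(∂) p` as a convolution. -/

section Convolution

variable {n : ℕ}

theorem sum_single_apply (S : Finset (Fin n)) (j : Fin n) :
    (∑ i ∈ S, Finsupp.single i 1 : Fin n →₀ ℕ) j = if j ∈ S then 1 else 0 := by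
  simp [Finsupp.finsetSum_apply, Finsupp.single_apply]

/-- A sum over the exponents of a multiaffine polynomial is a sum over the sets of variables. -/
theorem IsMultiaffine.sum_support {M : Type*} [AddCommMonoid M] {p : MvPolynomial (Fin n) ℝ}
    (hp : IsMultiaffine p) (f : (Fin n →₀ ℕ) → M) (hf : ∀ m, p.coeff m = 0 → f m = 0) :
    ∑ m ∈ p.support, f m = ∑ S : Finset (Fin n), f (∑ i ∈ S, Finsupp.single i 1) := by
  classical
  have hinj : Injective fun S : Finset (Fin n) => (∑ i ∈ S, Finsupp.single i 1 : Fin n →₀ ℕ) := by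
    intro S T hST
    ext j
    have := DFunLike.congr_fun hST j
    simp only [sum_single_apply] at this
    by_cases h1 : j ∈ S <;> by_cases h2 : j ∈ T <;> simp_all
  rw [← Finset.sum_image (f := f) (s := Finset.univ) hinj.injOn]
  refine Finset.sum_subset (fun m hm => ?_) fun m _ hm => hf m (notMem_support_iff.1 hm)
  refine Finset.mem_image.2 ⟨Finset.univ.filter fun i => m i = 1, Finset.mem_univ _, ?_⟩
  ext j
  have := degreeOf_le_iff.1 (hp j) m hm
  rw [sum_single_apply]
  by_cases h : m j = 1
  · simp [h]
  · simp [h]; omega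

theorem monomial_sum_single (S : Finset (Fin n)) (c : ℝ) :
    monomial (∑ i ∈ S, Finsupp.single i 1) c = c • ∏ i ∈ S, (X i : MvPolynomial (Fin n) ℝ) := by
  rw [smul_eq_C_mul, monomial_sum_index]
  rfl

theorem IsMultiaffine.eq_sum {p : MvPolynomial (Fin n) ℝ} (hp : IsMultiaffine p) :
    p = ∑ S : Finset (Fin n), p.coeff (∑ i ∈ S, Finsupp.single i 1) • ∏ i ∈ S, X i := by
  conv_lhs => rw [p.as_sum]
  rw [hp.sum_support (fun m => monomial m (p.coeff m)) fun m hm => by simp [hm]]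
  simp only [monomial_sum_single]

theorem flipPoly_eq_sum (q : MvPolynomial (Fin n) ℝ) :
    flipPoly q =
      ∑ S : Finset (Fin n), q.coeff (∑ i ∈ S, Finsupp.single i 1) • ∏ i ∈ Sᶜ, X i := by
  simp only [flipPoly, smul_eq_C_mul]

theorem partialPow_prod_X (S T : Finset (Fin n)) :
    partialPow (∑ i ∈ S, Finsupp.single i 1) (∏ i ∈ T, X i) =
      ∏ i, if i ∈ T then (if i ∈ S then 1 else X i) else (if i ∈ S then 0 else 1) := by
  have e : ∏ i ∈ T, (X i : MvPolynomial (Fin n) ℝ) = ∏ i, if i ∈ T then X i else 1 := by simp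
  rw [partialPow, e, list_prod_pow_derivation_apply_prod (fun i => pderiv i) _ _
    (fun i => if i ∈ T then (if i ∈ S then 1 else X i) else (if i ∈ S then 0 else 1))
    ?_ ?_ ?_ _ (List.nodup_finRange n)]
  · simp
  · intro i j hij
    split_ifs <;> simp [pderiv_X_of_ne hij]
  · intro i j hij
    split_ifs <;> simp [pderiv_X_of_ne hij]
  · intro i
    rw [sum_single_apply]
    by_cases hS : i ∈ S <;> by_cases hT : i ∈ T <;> simp [hS, hT]

/-- Factor by factor, `∂x + ∂y` sends `x, xy, 1, y` to `1, x + y, 0, 1`. This matches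
`partialPow_prod_X` with `z = x + y`. -/
theorem diagDerivs_prod_X (S T : Finset (Fin n)) :
    diagDerivs (List.finRange n)
        (rename Sum.inl (∏ i ∈ T, X i) * rename Sum.inr (∏ i ∈ Sᶜ, X i)) =
      ∏ i, if i ∈ T then (if i ∈ S then 1 else X (Sum.inl i) + X (Sum.inr i))
        else (if i ∈ S then 0 else 1) := by
  have e : rename Sum.inl (∏ i ∈ T, X i) * rename Sum.inr (∏ i ∈ Sᶜ, X i) =
      ∏ i : Fin n, ((if i ∈ T then X (Sum.inl i) else 1) * (if i ∈ S then 1 else X (Sum.inr i)) :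
        MvPolynomial (Fin n ⊕ Fin n) ℝ) := by
    have h : ∀ i : Fin n, (if i ∈ S then 1 else X (Sum.inr i)) =
        (if i ∈ Sᶜ then X (Sum.inr i) else 1 : MvPolynomial (Fin n ⊕ Fin n) ℝ) := by
      intro i; by_cases hS : i ∈ S <;> simp [hS]
    simp only [h, Finset.prod_mul_distrib, map_prod, rename_X, Finset.prod_ite_mem,
      Finset.univ_inter]
  have hk := list_prod_pow_derivation_apply_prod (fun i : Fin n => diagDeriv i) (fun _ => 1)
    (fun i => (if i ∈ T then X (Sum.inl i) else 1) * (if i ∈ S then 1 else X (Sum.inr i)))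
    (fun i => if i ∈ T then (if i ∈ S then 1 else X (Sum.inl i) + X (Sum.inr i))
        else (if i ∈ S then 0 else 1)) ?_ ?_ ?_ _ (List.nodup_finRange n)
  · simp only [pow_one] at hk
    rw [diagDerivs, e, hk]
    simp
  · intro i j hij
    split_ifs <;> simp [diagDeriv_apply, pderiv_X, hij]
  · intro i j hij
    split_ifs <;> simp [diagDeriv_apply, pderiv_X, hij]
  · intro i
    by_cases hS : i ∈ S <;> by_cases hT : i ∈ T <;>
      simp [hS, hT, diagDeriv_apply, pderiv_X, add_comm]

/-- Both sides are the symmetric additive convolution of `p` and the flip of `q`. -/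
theorem eval_diagDerivs_mul_flipPoly {p q : MvPolynomial (Fin n) ℝ} (hp : IsMultiaffine p)
    (hq : IsMultiaffine q) (x y : Fin n → ℝ) :
    eval (Sum.elim x y) (diagDerivs (List.finRange n)
      (rename Sum.inl p * rename Sum.inr (flipPoly q))) = eval (x + y) (applyDiff q p) := by
  have h : ∀ S T : Finset (Fin n),
      eval (Sum.elim x y) (diagDerivs (List.finRange n)
        (rename Sum.inl (∏ i ∈ T, X i) * rename Sum.inr (∏ i ∈ Sᶜ, X i))) =
      eval (x + y) (partialPow (∑ i ∈ S, Finsupp.single i 1) (∏ i ∈ T, X i)) := by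
    intro S T
    rw [partialPow_prod_X, diagDerivs_prod_X, map_prod, map_prod]
    refine Finset.prod_congr rfl fun i _ => ?_
    split_ifs <;> simp
  rw [applyDiff, hq.sum_support (fun m => q.coeff m • partialPow m p) fun m hm => by simp [hm],
    flipPoly_eq_sum]
  conv_lhs => rw [hp.eq_sum]
  conv_rhs => rw [hp.eq_sum]
  simp only [map_sum, map_smul, Finset.sum_mul_sum, smul_mul_smul_comm, smul_eval, h]
  rw [Finset.sum_comm]
  simp only [Finset.mul_sum]
  refine Finset.sum_congr rfl fun S _ => Finset.sum_congr rfl fun T _ => ?_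
  ring

theorem aeval_flipPoly {q : MvPolynomial (Fin n) ℝ} (hq : IsMultiaffine q) {z : Fin n → ℂ}
    (hz : ∀ i, z i ≠ 0) : aeval z (flipPoly q) = (∏ i, z i) * aeval (fun i => (z i)⁻¹) q := by
  rw [flipPoly_eq_sum]
  conv_rhs => rw [hq.eq_sum]
  simp only [map_sum, map_smul, map_prod, aeval_X, Finset.mul_sum]
  refine Finset.sum_congr rfl fun S _ => ?_
  rw [mul_smul_comm, ← Finset.prod_mul_prod_compl S z, Finset.prod_inv_distrib]
  have : ∏ i ∈ S, z i ≠ 0 := Finset.prod_ne_zero_iff.2 fun i _ => hz i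
  field_simp

/-- The flip is `∏ zᵢ * q(1 / z)`. Inversion lands in the lower half space, and real coefficients
allow conjugating back. -/
theorem IsRealStable.upperStable_flipPoly {q : MvPolynomial (Fin n) ℝ} (hq : IsMultiaffine q)
    (hs : IsRealStable q) : UpperStable (flipPoly q) := by
  intro z hz
  have hz0 : ∀ i, z i ≠ 0 := fun i h => by have := hz i; simp [h] at this
  rw [aeval_flipPoly hq hz0]
  refine mul_ne_zero (Finset.prod_ne_zero_iff.2 fun i _ => hz0 i) fun h0 => ?_
  refine hs (fun i => conj (z i)⁻¹) (fun i => ?_) ?_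
  · have := Complex.normSq_pos.2 (hz0 i)
    simpa [Complex.inv_im, neg_div] using div_pos (hz i) this
  · have := congrArg Complex.conjAe h0
    rw [map_zero, ← AlgEquiv.coe_toAlgHom, comp_aeval_apply] at this
    exact this

theorem degreesLeOne_flipPoly (q : MvPolynomial (Fin n) ℝ) : DegreesLeOne (flipPoly q) := by
  intro i
  refine (degreeOf_sum_le _ _ _).trans (Finset.sup_le fun S _ => ?_)
  refine (degreeOf_C_mul_le _ _ _).trans ((degreeOf_prod_le _ _ _).trans ?_)
  simp only [degreeOf_X]
  rw [Finset.sum_ite_eq]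
  split_ifs <;> simp

theorem inl_notMem_vars_rename_inr (g : MvPolynomial (Fin n) ℝ) (i : Fin n) :
    Sum.inl i ∉ (rename (Sum.inr : Fin n → Fin n ⊕ Fin n) g).vars := fun h => by
  obtain ⟨j, -, hj⟩ := mem_vars_rename _ _ h
  cases hj

theorem inr_notMem_vars_rename_inl (g : MvPolynomial (Fin n) ℝ) (i : Fin n) :
    Sum.inr i ∉ (rename (Sum.inl : Fin n → Fin n ⊕ Fin n) g).vars := fun h => by
  obtain ⟨j, -, hj⟩ := mem_vars_rename _ _ h
  cases hj

theorem degreesLeOne_rename_mul_rename {p g : MvPolynomial (Fin n) ℝ} (hp : DegreesLeOne p)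
    (hg : DegreesLeOne g) : DegreesLeOne (rename Sum.inl p * rename Sum.inr g) := by
  rintro (i | i)
  · have := inl_notMem_vars_rename_inr g i
    rw [mem_vars_iff_degreeOf_ne_zero, not_not] at this
    refine (degreeOf_mul_le _ _ _).trans ?_
    rw [this, degreeOf_rename_of_injective Sum.inl_injective]
    exact hp i
  · have := inr_notMem_vars_rename_inl p i
    rw [mem_vars_iff_degreeOf_ne_zero, not_not] at this
    refine (degreeOf_mul_le _ _ _).trans ?_
    rw [this, degreeOf_rename_of_injective Sum.inr_injective, zero_add]
    exact hg i

theorem diagDeriv_rename_mul_rename (p g : MvPolynomial (Fin n) ℝ) (i : Fin n) :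
    diagDeriv i (rename Sum.inl p * rename Sum.inr g) =
      rename Sum.inl (pderiv i p) * rename Sum.inr g +
        rename Sum.inl p * rename Sum.inr (pderiv i g) := by
  rw [diagDeriv_apply, pderiv_mul, pderiv_mul, pderiv_rename Sum.inl_injective,
    pderiv_rename Sum.inr_injective,
    pderiv_eq_zero_of_notMem_vars (inl_notMem_vars_rename_inr g i),
    pderiv_eq_zero_of_notMem_vars (inr_notMem_vars_rename_inl p i)]
  ring

theorem upperStable_rename_mul_rename {p g : MvPolynomial (Fin n) ℝ} (hp : UpperStable p)
    (hg : UpperStable g) : UpperStable (rename Sum.inl p * rename Sum.inr g) := by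
  intro z hz
  rw [map_mul, aeval_rename, aeval_rename]
  exact mul_ne_zero (hp _ fun i => hz _) (hg _ fun i => hz _)

end Convolution

/-! ### Assembling the theorem. -/

theorem DegreesLeOne.posAbove {σ : Type*} [Fintype σ] [DecidableEq σ] {F : MvPolynomial σ ℝ}
    (hF : DegreesLeOne F) {a : σ → ℝ} (h : ∀ v, a ≤ v → eval v F ≠ 0) (ha : 0 < eval a F) :
    PosAbove a F := by
  refine orthant_induction ha fun v hv hpos i t ht => ?_
  by_contra! hneg
  rw [hF.eval_update, add_sub_cancel_left] at hneg
  have hd : eval v (MvPolynomial.pderiv i F) < 0 := by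
    by_contra! hd
    have := mul_nonneg ht hd
    linarith
  refine h _ (le_update_add hv i (t := eval v F / -eval v (MvPolynomial.pderiv i F))
    (div_nonneg hpos.le (by linarith))) ?_
  rw [hF.eval_update, add_sub_cancel_left]
  field_simp [hd.ne]
  ring

theorem mainTheorem1 {n : ℕ} (p q : MvPolynomial (Fin n) ℝ)
    (hp : IsMultiaffine p) (hp' : IsRealStable p)
    (hq : IsMultiaffine q) (hq' : IsRealStable q)
    (hr : applyDiff q p ≠ 0)
    (a b : Fin n → ℝ)
    (ha : LiesAboveRoots a p) (hb : LiesAboveRoots b (flipPoly q))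
    (φ : Fin n → ℝ)
    (hφ : ∀ i, φ i = logPotential p i a + logPotential (flipPoly q) i b) :
    (∀ i, 0 < φ i) ∧ LiesAboveRoots (fun i => a i + b i - 1 / φ i) (applyDiff q p) := by
  set F := rename Sum.inl p * rename Sum.inr (flipPoly q) with hFdef
  have hid := eval_diagDerivs_mul_flipPoly hp hq
  have hFd : DegreesLeOne F := degreesLeOne_rename_mul_rename hp (degreesLeOne_flipPoly q)
  have hFs : UpperStable F := upperStable_rename_mul_rename hp' (hq'.upperStable_flipPoly hq)
  have hev : ∀ v, eval v F = eval (v ∘ Sum.inl) p * eval (v ∘ Sum.inr) (flipPoly q) := by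
    intro v
    rw [hFdef, map_mul, eval_rename, eval_rename]
  have hne : ∀ v, Sum.elim a b ≤ v → eval v F ≠ 0 := by
    intro v hv
    rw [hev]
    refine mul_ne_zero ?_ ?_
    · have := ha (v ∘ Sum.inl - a) fun i => sub_nonneg.2 (hv (Sum.inl i))
      rwa [add_sub_cancel] at this
    · have := hb (v ∘ Sum.inr - b) fun i => sub_nonneg.2 (hv (Sum.inr i))
      rwa [add_sub_cancel] at this
  have hF0 := hne _ le_rfl
  -- Normalising to the value 1 at the vertex turns nonvanishing into positivity.
  set c : ℝ := (eval (Sum.elim a b) F)⁻¹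
  have hc : c ≠ 0 := inv_ne_zero hF0
  have hcd : DegreesLeOne (c • F) := fun i => by
    rw [smul_eq_C_mul]
    exact (degreeOf_C_mul_le _ _ _).trans (hFd i)
  have hcs : UpperStable (c • F) := fun z hz => by
    rw [map_smul]
    exact smul_ne_zero hc (hFs z hz)
  have hc1 : eval (Sum.elim a b) (c • F) = 1 := by
    rw [smul_eval]; exact inv_mul_cancel₀ hF0
  have hpos : PosAbove (Sum.elim a b) (c • F) :=
    hcd.posAbove (fun v hv => by rw [smul_eval]; exact mul_ne_zero hc (hne v hv))
      (by rw [hc1]; exact one_pos)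
  have hpot : ∀ i, eval (Sum.elim a b) (diagDeriv i (c • F)) ≤
      φ i * eval (Sum.elim a b) (c • F) := by
    intro i
    have h1 : eval a p ≠ 0 := by simpa using ha 0 fun _ => le_rfl
    have h2 : eval b (flipPoly q) ≠ 0 := by simpa using hb 0 fun _ => le_rfl
    refine le_of_eq ?_
    rw [hc1, hφ, logPotential, logPotential, Derivation.map_smul, smul_eval, hFdef,
      diagDeriv_rename_mul_rename]
    simp only [c, hev, map_add, map_mul, eval_rename, Sum.elim_comp_inl, Sum.elim_comp_inr]
    field_simp
  have hne0 : diagDerivs (List.finRange n) (c • F) ≠ 0 := by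
    rw [map_smul]
    refine smul_ne_zero hc fun h0 => hr (MvPolynomial.funext fun x => ?_)
    have := hid x 0
    rw [h0, add_zero] at this
    simpa using this.symm
  obtain ⟨-, -, hφ0, a', ha', hx, hy, -⟩ :=
    hcs.exists_posAbove_diagDerivs hcd hpos hpot _ (List.nodup_finRange n) hne0
  refine ⟨fun i => hφ0 i (List.mem_finRange i), fun t ht h0 => ?_⟩
  -- Only the `x` half was lowered, so `y = b` is kept and `x + y` is the required point plus `t`.
  have := ha' (Sum.elim (fun i => a i - 1 / φ i + t i) b) (by
    rintro (i | i)
    · have := hx i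
      simp only [List.mem_finRange, if_true, Sum.elim_inl] at this ⊢
      linarith [ht i]
    · exact hy i)
  rw [map_smul, smul_eval, hid] at this
  have e : (fun i => a i - 1 / φ i + t i) + b = (fun i => a i + b i - 1 / φ i) + t := by
    ext i; simp only [Pi.add_apply]; ring
  rw [e, h0, mul_zero] at this
  exact lt_irrefl _ this
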